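/- For $k\ge 0$ let $\mathbb{B}^k$ be the open unit ball of $\mathbb{C}^k$ (Euclidean norm) and let $\mathrm{Aut}(\mathbb{B}^k)$ be the group of its biholomorphic self-maps under composition. For a holomorphic map $f:\mathbb{B}^n\to\mathbb{B}^N$ let $$A_f=\{(\gamma,\psi)\in \mathrm{Aut}(\mathbb{B}^n)\times\mathrm{Aut}(\mathbb{B}^N) : f\circ\gamma=\psi\circ f\},$$ let $\Gamma_f\subseteq\mathrm{Aut}(\mathbb{B}^n)$ and $T_f\subseteq\mathrm{Aut}(\mathbb{B}^N)$ be the projections of $A_f$ onto the first and second factor, and let $G_f=\{\gamma\in\mathrm{Aut}(\mathbb{B}^n): f\circ\gamma=f\}$. The map $f$ is called minimal if its image lies in no complex affine subspace of $\mathbb{C}^N$ of dimension less than $N$. Proposition 3.2. Let $f:\mathbb{B}^n\to\mathbb{B}^N$ be a proper holomorphic map that is minimal. Then $f$ induces a unique group homomorphism $\Phi:\Gamma_f\to T_f$ such that, for every $\gamma\in\Gamma_f$, $\Phi(\gamma)$ is the one and only $\psi\in\mathrm{Aut}(\mathbb{B}^N)$ with $f\circ\gamma=\psi\circ f$. Its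 kernel satisfies $\mathrm{Ker}(\Phi)=G_f$, and it is a finite subgroup of $\mathrm{Aut}(\mathbb{B}^n)$. -/

import Mathlib

/-- The open unit ball `𝔹ⁿ` of complex Euclidean space `ℂⁿ`. -/
abbrev unitBall (n : ℕ) : Set (EuclideanSpace ℂ (Fin n)) := Metric.ball 0 1

/-- A map between unit balls is holomorphic if it is the restriction to the open unit ball of a
function that is complex differentiable at each point of the ball. (The values of `F` outside the
ball play no role.) -/
def IsHolomorphicMap {n N : ℕ} (f : unitBall n → unitBall N) : Prop :=
  ∃ F : EuclideanSpace ℂ (Fin n) → EuclideanSpace ℂ (Fin N),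
    DifferentiableOn ℂ F (unitBall n) ∧ ∀ z : unitBall n, F z = f z

theorem IsHolomorphicMap.id (n : ℕ) : IsHolomorphicMap (fun z : unitBall n => z) :=
  ⟨fun z => z, differentiableOn_id, fun _ => rfl⟩

theorem IsHolomorphicMap.comp {n m N : ℕ} {g : unitBall m → unitBall N}
    {f : unitBall n → unitBall m} (hg : IsHolomorphicMap g) (hf : IsHolomorphicMap f) :
    IsHolomorphicMap (g ∘ f) := by
  obtain ⟨G, hG, hG'⟩ := hg
  obtain ⟨F, hF, hF'⟩ := hf
  refine ⟨G ∘ F, hG.comp hF ?_, fun z => ?_⟩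
  · intro z hz
    have h := hF' ⟨z, hz⟩
    simp only at h
    rw [h]
    exact (f ⟨z, hz⟩).2
  · simp only [Function.comp_apply, hF', hG']

/-- The holomorphic automorphism group `Aut(𝔹ⁿ)`: the biholomorphic bijections of the ball, a group
under composition. -/
def ballAut (n : ℕ) : Subgroup (Equiv.Perm (unitBall n)) where
  carrier := {γ | IsHolomorphicMap γ ∧ IsHolomorphicMap γ.symm}
  one_mem' := ⟨IsHolomorphicMap.id n, IsHolomorphicMap.id n⟩
  mul_mem' := fun ha hb => ⟨ha.1.comp hb.1, hb.2.comp ha.2⟩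
  inv_mem' := fun ha => ⟨ha.2, ha.1⟩

/-- The underlying self-map of the ball of an automorphism. -/
def ballAut.toFun {n : ℕ} (γ : ballAut n) : unitBall n → unitBall n :=
  fun z => (γ : Equiv.Perm (unitBall n)) z

/-- `f` is minimal if its image lies in no affine linear subspace of `ℂᴺ` of dimension less
than `N`. -/
def IsMinimalMap {n N : ℕ} (f : unitBall n → unitBall N) : Prop :=
  ¬ ∃ S : AffineSubspace ℂ (EuclideanSpace ℂ (Fin N)),
    Module.finrank ℂ S.direction < N ∧ ∀ z, (f z : EuclideanSpace ℂ (Fin N)) ∈ S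

/-- The group `A_f` of the pairs `(γ, ψ)` of automorphisms with `f ∘ γ = ψ ∘ f`. -/
def pairGroup {n N : ℕ} (f : unitBall n → unitBall N) : Subgroup (ballAut n × ballAut N) where
  carrier := {p | f ∘ ballAut.toFun p.1 = ballAut.toFun p.2 ∘ f}
  one_mem' := rfl
  mul_mem' := by
    intro a b ha hb
    funext z
    have h1 := congrFun ha (ballAut.toFun b.1 z)
    have h2 := congrFun hb z
    exact h1.trans (congrArg (ballAut.toFun a.2) h2)
  inv_mem' := by
    intro a ha
    funext z
    have h := congrFun ha (ballAut.toFun a.1⁻¹ z)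
    have e1 : ballAut.toFun a.1 (ballAut.toFun a.1⁻¹ z) = z :=
      (a.1 : Equiv.Perm (unitBall n)).apply_symm_apply z
    have e2 : ballAut.toFun a.2⁻¹ (ballAut.toFun a.2 (f (ballAut.toFun a.1⁻¹ z)))
        = f (ballAut.toFun a.1⁻¹ z) :=
      (a.2 : Equiv.Perm (unitBall N)).symm_apply_apply _
    simp only [Function.comp_apply, e1] at h
    rw [← h] at e2
    exact e2.symm

/-- `Γ_f`, the projection of `A_f` to `Aut(𝔹ⁿ)`. -/
def sourceGroup {n N : ℕ} (f : unitBall n → unitBall N) : Subgroup (ballAut n) :=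
  (pairGroup f).map (MonoidHom.fst (ballAut n) (ballAut N))

/-- `T_f`, the projection of `A_f` to `Aut(𝔹ᴺ)`. -/
def targetGroup {n N : ℕ} (f : unitBall n → unitBall N) : Subgroup (ballAut N) :=
  (pairGroup f).map (MonoidHom.snd (ballAut n) (ballAut N))

/-- `G_f`, the group of the source automorphisms `γ` with `f ∘ γ = f`. -/
def invariantGroup {n N : ℕ} (f : unitBall n → unitBall N) : Subgroup (ballAut n) where
  carrier := {γ | f ∘ ballAut.toFun γ = f}
  one_mem' := rfl
  mul_mem' := by
    intro a b ha hb
    funext z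
    exact (congrFun ha (ballAut.toFun b z)).trans (congrFun hb z)
  inv_mem' := by
    intro a ha
    funext z
    have h := congrFun ha (ballAut.toFun a⁻¹ z)
    have e1 : ballAut.toFun a (ballAut.toFun a⁻¹ z) = z :=
      (a : Equiv.Perm (unitBall n)).apply_symm_apply z
    simp only [Function.comp_apply, e1] at h
    exact h.symm

/-- `Φ : Γ_f → T_f` is the homomorphism induced by `f`: for `γ ∈ Γ_f`, the value `Φ γ` is the one
and only target automorphism `ψ` with `(γ, ψ) ∈ A_f`, that is, with `f ∘ γ = ψ ∘ f`. -/
def IsInducedHom {n N : ℕ} (f : unitBall n → unitBall N)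
    (Φ : sourceGroup f →* targetGroup f) : Prop :=
  ∀ (γ : sourceGroup f) (ψ : ballAut N),
    ((γ : ballAut n), ψ) ∈ pairGroup f ↔ ψ = (Φ γ : ballAut N)

/-! Automorphisms of a ball are projective: each is a Möbius involution followed by a unitary map,
so it lifts to a linear similitude of the Hermitian form of signature `(1, n)`. Uniqueness of `ψ`
reduces to `eq_one_of_fixes_minimal`. If `ψ` fixes the image of `f`, the vectors `(f z, 1)` are
eigenvectors of its lift. The form never vanishes between points of the ball, so the eigenvalues
coincide. One eigenspace thus cuts out an affine subspace containing the image, and minimality makes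
it everything. The homomorphism and its kernel then follow formally. For finiteness, suppose that
`G_f` is infinite. It moves the origin within a compact fibre of `f`, so the lifts are bounded, and
quotients of a convergent sequence of lifts give nontrivial elements tending to the identity
(`exists_lifts_tendsto_one`). Rescaled, their differences from the identity converge to a nonzero
infinitesimal projective transformation whose field is annihilated by `df`
(`exists_projectiveField_of_tendsto_one`). Since `df` is complex linear, the flow in complex time
stays in the compact fibres; Liouville's theorem makes it constant, so the field vanishes on the
ball, a contradiction. -/

/-! ### Complex flows of projective vector fields -/

section Flow

open Filter Topology

variable {E F : Type*} [NormedAddCommGroup E] [NormedSpace ℂ E]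
  [NormedAddCommGroup F] [NormedSpace ℂ F]

/-- The vector field on `E`, in the affine chart `z ↦ (z, 1)`, of the infinitesimal projective
transformation given by an endomorphism of `E × ℂ`. -/
noncomputable def projectiveField (V : E × ℂ →L[ℂ] E × ℂ) (y : E) : E :=
  (V (y, 1)).1 - (V (y, 1)).2 • y

/-- By the quotient rule, the chart carries the linear field of `V` to `projectiveField V`; linear
orbits therefore become integral curves wherever the last coordinate is nonzero. -/
theorem hasDerivAt_affineChart {V : E × ℂ →L[ℂ] E × ℂ} {e : ℂ → E × ℂ} {ζ : ℂ}
    (he : HasDerivAt e (V (e ζ)) ζ) (h0 : (e ζ).2 ≠ 0) :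
    HasDerivAt (fun t => (e t).2⁻¹ • (e t).1)
      (projectiveField V ((e ζ).2⁻¹ • (e ζ).1)) ζ := by
  have h1 : HasDerivAt (fun t => (e t).1) (V (e ζ)).1 ζ := 
    (ContinuousLinearMap.fst ℂ E ℂ).hasFDerivAt.comp_hasDerivAt ζ he
  have h2 : HasDerivAt (fun t => (e t).2) (V (e ζ)).2 ζ := 
    (ContinuousLinearMap.snd ℂ E ℂ).hasFDerivAt.comp_hasDerivAt ζ he
  have h3 := (h2.inv h0).smul h1
  have e1 : V ((e ζ).2⁻¹ • (e ζ).1, 1) = (e ζ).2⁻¹ • V (e ζ) := by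
    rw [← map_smul]
    congr 1
    ext1
    · rfl
    · simp [h0]
  refine h3.congr_deriv ?_
  rw [projectiveField, e1]
  simp only [Prod.smul_fst, Prod.smul_snd, smul_smul, smul_eq_mul, Pi.inv_apply]
  rw [sub_eq_add_neg, ← neg_smul]
  congr 2
  field_simp

theorem exp_apply_ne_zero [CompleteSpace E] (V : E →L[ℂ] E) {v : E} (hv : v ≠ 0) :
    NormedSpace.exp V v ≠ 0 := by
  intro h
  let : NormedAlgebra ℚ (E →L[ℂ] E) := .restrictScalars ℚ ℂ _
  obtain ⟨u, hu⟩ := NormedSpace.isUnit_exp V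
  have h1 : ((↑u⁻¹ : E →L[ℂ] E) * (u : E →L[ℂ] E)) v = v := by simp
  rw [hu, mul_apply_eq_comp, h, map_zero] at h1
  exact hv h1.symm

/-- If `F` has compact fibres and its differential annihilates a projective vector field, then
the field vanishes: its complex orbits lie in the fibres, so that Liouville's theorem applies. -/
theorem projectiveField_eq_zero_of_fderiv_eq_zero [CompleteSpace E] {U : Set E} (hU : IsOpen U)
    {f : E → F} (hf : DifferentiableOn ℂ f U)
    (hK : ∀ p ∈ U, IsCompact {z | z ∈ U ∧ f z = f p}) (V : E × ℂ →L[ℂ] E × ℂ)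
    (hV : ∀ y ∈ U, fderiv ℂ f y (projectiveField V y) = 0) {p : E} (hp : p ∈ U) :
    projectiveField V p = 0 := by
  set K := {z | z ∈ U ∧ f z = f p} with hKdef
  have hKc : IsCompact K := hK p hp
  set e : ℂ → E × ℂ := fun ζ => NormedSpace.exp (ζ • V) (p, 1) with he
  have hder : ∀ ζ, HasDerivAt e (V (e ζ)) ζ := fun ζ => by
    have := (hasDerivAt_exp_smul_const' V ζ).clm_apply (hasDerivAt_const ζ ((p, 1) : E × ℂ))
    simpa using this
  have hcont : Continuous e := continuous_iff_continuousAt.2 fun ζ => (hder ζ).continuousAt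
  have hne : ∀ ζ, e ζ ≠ 0 := fun ζ => exp_apply_ne_zero _ (by simp)
  have he0 : e 0 = (p, 1) := by
    let : NormedAlgebra ℚ (E × ℂ →L[ℂ] E × ℂ) := .restrictScalars ℚ ℂ _
    change NormedSpace.exp ((0 : ℂ) • V) (p, 1) = _
    rw [zero_smul ℂ V, NormedSpace.exp_zero, one_apply_eq_self]
  set c : ℂ → E := fun ζ => (e ζ).2⁻¹ • (e ζ).1 with hc
  have hcder : ∀ ζ, (e ζ).2 ≠ 0 → HasDerivAt c (projectiveField V (c ζ)) ζ :=
    fun ζ h => hasDerivAt_affineChart (hder ζ) h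
  -- The set of times at which the orbit is in the chart and in the fibre is shown to be clopen in
  -- `ℂ`. Openness holds because `f ∘ c` has zero derivative.
  set S : Set ℂ := {ζ | (e ζ).2 ≠ 0 ∧ c ζ ∈ K} with hS
  have hSopen : IsOpen S := by
    rw [Metric.isOpen_iff]
    rintro ζ₀ ⟨h0, h0K⟩
    have ev1 : ∀ᶠ ζ in 𝓝 ζ₀, (e ζ).2 ≠ 0 :=
      (hcont.snd.continuousAt).eventually_ne h0
    have ev2 : ∀ᶠ ζ in 𝓝 ζ₀, c ζ ∈ U :=
      (hcder ζ₀ h0).continuousAt.eventually_mem (hU.mem_nhds h0K.1)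
    obtain ⟨r, hr, hball⟩ := Metric.eventually_nhds_iff_ball.1 (ev1.and ev2)
    refine ⟨r, hr, fun ζ hζ => ⟨(hball ζ hζ).1, (hball ζ hζ).2, ?_⟩⟩
    have hd : ∀ t ∈ Metric.ball ζ₀ r, HasDerivAt (f ∘ c) 0 t := fun t ht => by
      have h1 := hball t ht
      have h2 : HasFDerivAt f (fderiv ℂ f (c t)) (c t) :=
        ((hf _ h1.2).differentiableAt (hU.mem_nhds h1.2)).hasFDerivAt
      exact (h2.comp_hasDerivAt t (hcder t h1.1)).congr_deriv (hV _ h1.2)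
    have := Metric.isOpen_ball.is_const_of_deriv_eq_zero
      (convex_ball ζ₀ r).isPreconnected
      (fun t ht => (hd t ht).differentiableAt.differentiableWithinAt)
      (fun t ht => (hd t ht).deriv) hζ (Metric.mem_ball_self hr)
    exact this.trans h0K.2
  have hSclosed : IsClosed S := by
    refine isClosed_of_closure_subset fun ζ hζ => ?_
    -- Boundedness of `K` keeps the orbit away from the hyperplane at infinity: in the limit, a
    -- vanishing last coordinate would force the whole vector to vanish.
    obtain ⟨R, hR⟩ := hKc.isBounded.exists_norm_le
    have hsub : S ⊆ {ζ | ‖(e ζ).1‖ ≤ R * ‖(e ζ).2‖} := by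
      rintro t ⟨h0, htK⟩
      have h1 := hR _ htK
      rw [hc, norm_smul, norm_inv, inv_mul_le_iff₀ (norm_pos_iff.2 h0)] at h1
      simpa [mul_comm] using h1
    have hcl : IsClosed {ζ | ‖(e ζ).1‖ ≤ R * ‖(e ζ).2‖} :=
      isClosed_le hcont.fst.norm (continuous_const.mul hcont.snd.norm)
    have h1 : ‖(e ζ).1‖ ≤ R * ‖(e ζ).2‖ := closure_minimal hsub hcl hζ
    have h0 : (e ζ).2 ≠ 0 := by
      intro h
      rw [h, norm_zero, mul_zero, norm_le_zero_iff] at h1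
      exact hne ζ (Prod.ext h1 h)
    refine ⟨h0, ?_⟩
    have h2 := (hcder ζ h0).continuousAt.continuousWithinAt.mem_closure hζ
      (fun t (ht : t ∈ S) => ht.2)
    rwa [hKc.isClosed.closure_eq] at h2
  have hSuniv : S = Set.univ :=
    IsClopen.eq_univ ⟨hSclosed, hSopen⟩ ⟨0, by simp [hS, hc, he0, hKdef, hp]⟩
  have hmem : ∀ ζ, ζ ∈ S := fun ζ => hSuniv ▸ Set.mem_univ ζ
  have hdiff : Differentiable ℂ c := fun ζ => (hcder ζ (hmem ζ).1).differentiableAt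
  have hbdd : Bornology.IsBounded (Set.range c) :=
    hKc.isBounded.subset (by rintro _ ⟨ζ, rfl⟩; exact (hmem ζ).2)
  have hconst : c = fun _ => c 0 := funext fun ζ => hdiff.apply_eq_apply_of_bounded hbdd ζ 0
  have h1 := hcder 0 (hmem 0).1
  have h2 : HasDerivAt c 0 0 := by rw [hconst]; exact hasDerivAt_const 0 _
  have h3 := h1.unique h2
  simpa [hc, he0] using h3

/-- An endomorphism of `E × ℂ` with vanishing lower right entry is determined by its projective
vector field. -/
theorem eq_zero_of_projectiveField_eq_zero {V : E × ℂ →L[ℂ] E × ℂ} {r : ℝ} (hr : 0 < r)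
    (h0 : (V (0, 1)).2 = 0) (h : ∀ y ∈ Metric.ball (0 : E) r, projectiveField V y = 0) :
    V = 0 := by
  have hb : (V (0, 1)).1 = 0 := by
    simpa [projectiveField] using h 0 (Metric.mem_ball_self hr)
  have h01 : V (0, 1) = 0 := Prod.ext hb h0
  have hV1 : ∀ y, V (y, 1) = V (y, 0) := fun y => by
    rw [show ((y, 1) : E × ℂ) = (y, 0) + (0, 1) by simp, map_add, h01, add_zero]
  have hsc : ∀ (t : ℂ) y, V (t • y, 0) = t • V (y, 0) := fun t y => by
    rw [← map_smul]; simp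
  have hball : ∀ y ∈ Metric.ball (0 : E) r, V (y, 0) = 0 := by
    intro y hy
    have h1 := h y hy
    -- On this ball the field is a linear term minus a quadratic one. Halving `y` scales them by
    -- `1/2` and `1/4`, so comparing the two equations separates them.
    have h2 := h ((2⁻¹ : ℂ) • y) (by
      rw [mem_ball_zero_iff] at hy ⊢
      rw [norm_smul]
      have : ‖(2⁻¹ : ℂ)‖ = 2⁻¹ := by simp
      rw [this]
      linarith [norm_nonneg y])
    simp only [projectiveField, hV1, hsc, sub_eq_zero, Prod.smul_fst, Prod.smul_snd, smul_smul,
      smul_eq_mul] at h1 h2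
    have h3 : (4⁻¹ : ℂ) • (V (y, 0)).2 • y = 0 := by
      rw [h1, smul_smul] at h2
      rw [smul_smul, ← sub_eq_zero.2 h2, ← sub_smul]
      congr 1
      ring
    have h4 : (V (y, 0)).2 • y = 0 := (smul_eq_zero.1 h3).resolve_left (by norm_num)
    refine Prod.ext (h1.trans h4) ?_
    rcases smul_eq_zero.1 h4 with h5 | h5
    · exact h5
    · rw [h5]; exact congrArg Prod.snd (map_zero V)
  have hall : ∀ y, V (y, 0) = 0 := by
    intro y
    have hpos : 0 < ‖y‖ + 1 := by positivity
    have hne : ((r / (‖y‖ + 1) : ℝ) : ℂ) ≠ 0 := by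
      exact_mod_cast (div_pos hr hpos).ne'
    have h1 := hball (((r / (‖y‖ + 1) : ℝ) : ℂ) • y) (by
      rw [mem_ball_zero_iff, norm_smul, Complex.norm_real, Real.norm_of_nonneg (by positivity),
        div_mul_eq_mul_div, div_lt_iff₀ hpos]
      nlinarith [norm_nonneg y])
    rw [hsc] at h1
    exact (smul_eq_zero.1 h1).resolve_left hne
  refine ContinuousLinearMap.ext fun ⟨y, t⟩ => ?_
  rw [show ((y, t) : E × ℂ) = (y, 0) + t • (0, 1) by simp, map_add, map_smul, h01, hall]
  simp

end Flow

/-! ### Infinitesimal transformations as limits of projective ones -/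

section Limit

open Filter Topology

variable {E F : Type*} [NormedAddCommGroup E] [NormedSpace ℂ E]
  [NormedAddCommGroup F] [NormedSpace ℂ F]

theorem Filter.Tendsto.continuousLinearMap_apply {α : Type*} {l : Filter α}
    {W : α → E →L[ℂ] F} {V : E →L[ℂ] F} (h : Tendsto W l (𝓝 V)) (v : E) :
    Tendsto (fun j => W j v) l (𝓝 (V v)) :=
  ((ContinuousLinearMap.apply ℂ F v).continuous.tendsto V).comp h

theorem Filter.Tendsto.projectiveField {α : Type*} {l : Filter α}
    {W : α → E × ℂ →L[ℂ] E × ℂ} {V : E × ℂ →L[ℂ] E × ℂ} (h : Tendsto W l (𝓝 V)) (y : E) :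
    Tendsto (fun j => projectiveField (W j) y) l (𝓝 (projectiveField V y)) := by
  have h1 : Tendsto (fun j => W j (y, 1)) l (𝓝 (V (y, 1))) := h.continuousLinearMap_apply _
  exact ((continuous_fst.tendsto _).comp h1).sub
    (((continuous_snd.tendsto _).comp h1).smul tendsto_const_nhds)

/-- Displacement of a point under the projective transformation with matrix `m (1 + u W)`. -/
theorem affineChart_sub_self {M W : E × ℂ →L[ℂ] E × ℂ} {m u : ℂ} (hm : m ≠ 0) (hu : u ≠ 0)
    (hW : u • W = m⁻¹ • M - 1) {y : E} (h : (M (y, 1)).2 ≠ 0) :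
    u⁻¹ • ((M (y, 1)).2⁻¹ • (M (y, 1)).1 - y) =
      (m * (M (y, 1)).2⁻¹) • projectiveField W y := by
  have hM : M (y, 1) = m • ((y, 1) + u • W (y, 1)) := by
    have h1 : u • W (y, 1) = m⁻¹ • M (y, 1) - (y, 1) := by
      have := congrArg (fun T : E × ℂ →L[ℂ] E × ℂ => T (y, 1)) hW
      simpa using this
    rw [h1, add_sub_cancel, smul_inv_smul₀ hm]
  have h1 : (M (y, 1)).1 = m • (y + u • (W (y, 1)).1) := by rw [hM]; rfl
  have h2 : (M (y, 1)).2 = m * (1 + u * (W (y, 1)).2) := by rw [hM]; rfl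
  set q := (M (y, 1)).2 with hq
  rw [h1, projectiveField]
  match_scalars
  · field_simp
    linear_combination -h2
  · field_simp

/-- A sequence of nontrivial projective transformations converging to the identity produces a
nonzero infinitesimal transformation; it annihilates every function invariant under the
sequence. -/
theorem exists_projectiveField_of_tendsto_one [FiniteDimensional ℂ E]
    {M : ℕ → E × ℂ →L[ℂ] E × ℂ} (hM : Tendsto M atTop (𝓝 1))
    (hscalar : ∀ j (c : ℂ), M j ≠ c • 1) :
    ∃ V : E × ℂ →L[ℂ] E × ℂ, V ≠ 0 ∧ (V (0, 1)).2 = 0 ∧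
      ∀ (f : E → F) (f' : E →L[ℂ] F) (y : E), HasFDerivAt f f' y →
        (∀ j, f ((M j (y, 1)).2⁻¹ • (M j (y, 1)).1) = f y) → f' (projectiveField V y) = 0 := by
  have hval : ∀ y : E, Tendsto (fun j => M j (y, 1)) atTop (𝓝 (y, 1)) := fun y => by
    simpa using hM.continuousLinearMap_apply (y, 1)
  have hval2 : ∀ y : E, Tendsto (fun j => (M j (y, 1)).2) atTop (𝓝 1) := fun y =>
    (continuous_snd.tendsto _).comp (hval y)
  have hval1 : ∀ y : E, Tendsto (fun j => (M j (y, 1)).1) atTop (𝓝 y) := fun y =>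
    (continuous_fst.tendsto _).comp (hval y)
  set m : ℕ → ℂ := fun j => (M j (0, 1)).2 with hm
  have hm1 : Tendsto m atTop (𝓝 1) := hval2 0
  have hm0 : ∀ᶠ j in atTop, m j ≠ 0 := hm1.eventually_ne one_ne_zero
  -- Dividing by the lower right entry removes the scalar ambiguity of the lift: the lower right
  -- entry of `Z j` is zero whenever `m j ≠ 0`.
  set Z : ℕ → E × ℂ →L[ℂ] E × ℂ := fun j => (m j)⁻¹ • M j - 1 with hZ
  have hZ0 : ∀ j, Z j ≠ 0 := by
    intro j h
    rw [hZ, sub_eq_zero] at h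
    -- If `m j = 0`, the convention `0⁻¹ = 0` gives `Z j = -1`, which is still nonzero.
    by_cases h0 : m j = 0
    · rw [h0, inv_zero] at h
      exact zero_ne_one ((zero_smul ℂ (M j)).symm.trans h)
    · exact hscalar j (m j) (by rw [← h, smul_inv_smul₀ h0])
  set u : ℕ → ℂ := fun j => (‖Z j‖ : ℂ) with hu
  have hu0 : ∀ j, u j ≠ 0 := fun j => by simpa [hu] using hZ0 j
  set W : ℕ → E × ℂ →L[ℂ] E × ℂ := fun j => (u j)⁻¹ • Z j with hW
  have hWs : ∀ j, W j ∈ Metric.sphere (0 : E × ℂ →L[ℂ] E × ℂ) 1 := fun j => by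
    simp [hW, hu, norm_smul, hZ0 j]
  have : ProperSpace (E × ℂ →L[ℂ] E × ℂ) := FiniteDimensional.proper ℂ _
  obtain ⟨V, hV, φ, hφ, hlim⟩ := (isCompact_sphere (0 : E × ℂ →L[ℂ] E × ℂ) 1).tendsto_subseq hWs
  refine ⟨V, ?_, ?_, ?_⟩
  · rintro rfl
    simp at hV
  · have h1 : Tendsto (fun j => ((W (φ j)) (0, 1)).2) atTop (𝓝 (V (0, 1)).2) :=
      (continuous_snd.tendsto _).comp (hlim.continuousLinearMap_apply _)
    refine tendsto_nhds_unique h1 (tendsto_const_nhds.congr' ?_)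
    filter_upwards [hφ.tendsto_atTop.eventually hm0] with j hj
    have : (W (φ j) (0, 1)).2 = (u (φ j))⁻¹ * ((m (φ j))⁻¹ * m (φ j) - 1) := by
      simp [hW, hZ, hm]
    rw [this, inv_mul_cancel₀ hj, sub_self, mul_zero]
  · intro f f' y hf hinv
    set d : ℕ → E := fun j => (M (φ j) (y, 1)).2⁻¹ • (M (φ j) (y, 1)).1 - y with hd
    have hd0 : Tendsto d atTop (𝓝 0) := by
      have h1 := (((hval2 y).inv₀ one_ne_zero).smul (hval1 y)).sub_const y
      simp only [inv_one, one_smul, sub_self] at h1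
      exact h1.comp hφ.tendsto_atTop
    have hcd : Tendsto (fun j => (u (φ j))⁻¹ • d j) atTop (𝓝 (projectiveField V y)) := by
      have h1 := ((hm1.mul ((hval2 y).inv₀ one_ne_zero)).comp hφ.tendsto_atTop).smul
        (hlim.projectiveField y)
      simp only [inv_one, one_smul, mul_one] at h1
      refine h1.congr' ?_
      filter_upwards [hφ.tendsto_atTop.eventually hm0,
        hφ.tendsto_atTop.eventually ((hval2 y).eventually_ne one_ne_zero)] with j hj hj'
      refine (affineChart_sub_self hj (hu0 _) ?_ hj').symm
      simp only [Function.comp_apply, hW]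
      rw [smul_inv_smul₀ (hu0 _)]
    -- The quotients of the increments of `f` along `d j` by `u (φ j)` tend to the derivative along
    -- the field, and invariance makes them all zero.
    have h1 := hf.hasFDerivWithinAt (s := Set.univ) |>.lim hd0 (by simp) hcd
    refine tendsto_nhds_unique h1 (tendsto_const_nhds.congr fun j => ?_)
    rw [hd, add_sub_cancel, hinv, sub_self, smul_zero]

end Limit

/-! ### The Lorentz form and Möbius involutions -/

section Moebius

open scoped ComplexConjugate

variable {E : Type*} [NormedAddCommGroup E] [InnerProductSpace ℂ E]

/-- The Hermitian form of signature `(1, n)` on `E × ℂ`. -/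
noncomputable def lorentzForm (x y : E × ℂ) : ℂ := conj x.2 * y.2 - inner ℂ x.1 y.1

theorem lorentzForm_smul_smul (c d : ℂ) (x y : E × ℂ) :
    lorentzForm (c • x) (d • y) = conj c * d * lorentzForm x y := by
  simp only [lorentzForm, Prod.smul_fst, Prod.smul_snd, inner_smul_left, inner_smul_right,
    smul_eq_mul, map_mul]
  ring

theorem lorentzForm_self (x : E × ℂ) :
    lorentzForm x x = ((‖x.2‖ ^ 2 - ‖x.1‖ ^ 2 : ℝ) : ℂ) := by
  rw [lorentzForm, inner_self_eq_norm_sq_to_K, mul_comm, Complex.mul_conj,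
    Complex.normSq_eq_norm_sq]
  push_cast
  rfl

/-- The linear map of `E × ℂ` inducing the involutive automorphism of the ball that exchanges `0`
and `a`. -/
noncomputable def moebiusMatrix (a : E) : E × ℂ →L[ℂ] E × ℂ :=
  ((ContinuousLinearMap.snd ℂ E ℂ).smulRight a
      - ((√(1 - ‖a‖ ^ 2) : ℝ) : ℂ) • ContinuousLinearMap.fst ℂ E ℂ
      - (((1 + √(1 - ‖a‖ ^ 2) : ℝ) : ℂ)⁻¹) •
        ((innerSL ℂ a).comp (ContinuousLinearMap.fst ℂ E ℂ)).smulRight a).prod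
    (ContinuousLinearMap.snd ℂ E ℂ - (innerSL ℂ a).comp (ContinuousLinearMap.fst ℂ E ℂ))

/-- With `s = √(1 - ‖a‖²)` and `P`, `Q` the projections along and orthogonal to `a`, this is the
classical numerator `a - P z - s Q z`, homogenized. Writing `(1 - s) / ‖a‖²` as `1 / (1 + s)` covers
`a = 0`. -/
theorem moebiusMatrix_apply_fst (a : E) (x : E × ℂ) :
    (moebiusMatrix a x).1 = x.2 • a - ((√(1 - ‖a‖ ^ 2) : ℝ) : ℂ) • x.1
      - ((((1 + √(1 - ‖a‖ ^ 2) : ℝ) : ℂ)⁻¹) * inner ℂ a x.1) • a := by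
  simp [moebiusMatrix, smul_smul]

theorem moebiusMatrix_apply_snd (a : E) (x : E × ℂ) :
    (moebiusMatrix a x).2 = x.2 - inner ℂ a x.1 := by
  simp [moebiusMatrix]

theorem moebiusMatrix_zero_one (a : E) : moebiusMatrix a (0, 1) = (a, 1) := by
  refine Prod.ext ?_ ?_
  · rw [moebiusMatrix_apply_fst]
    simp
  · rw [moebiusMatrix_apply_snd]
    simp

/-- Each of the three terms of the first component has norm at most `‖x‖`. Uniformity in `a` is what
later gives convergent subsequences of lifts. -/
theorem norm_moebiusMatrix_le {a : E} (ha : ‖a‖ < 1) : ‖moebiusMatrix a‖ ≤ 3 := by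
  have hs0 : 0 ≤ √(1 - ‖a‖ ^ 2) := Real.sqrt_nonneg _
  have hs1 : √(1 - ‖a‖ ^ 2) ≤ 1 := Real.sqrt_le_one.2 (by nlinarith [norm_nonneg a])
  refine ContinuousLinearMap.opNorm_le_bound _ (by norm_num) fun x => ?_
  have h1 : ‖x.1‖ ≤ ‖x‖ := norm_fst_le x
  have h2 : ‖x.2‖ ≤ ‖x‖ := norm_snd_le x
  have h3 : ‖inner ℂ a x.1‖ ≤ ‖x‖ := (norm_inner_le_norm a x.1).trans
    ((mul_le_of_le_one_left (norm_nonneg _) ha.le).trans h1)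
  rw [Prod.norm_def, moebiusMatrix_apply_fst, moebiusMatrix_apply_snd]
  refine max_le ?_ ?_
  · have e1 : ‖x.2 • a‖ ≤ ‖x‖ := by
      rw [norm_smul]
      exact (mul_le_of_le_one_right (norm_nonneg _) ha.le).trans h2
    have e2 : ‖((√(1 - ‖a‖ ^ 2) : ℝ) : ℂ) • x.1‖ ≤ ‖x‖ := by
      rw [norm_smul, Complex.norm_real, Real.norm_of_nonneg hs0]
      exact (mul_le_of_le_one_left (norm_nonneg _) hs1).trans h1
    have e3 : ‖((((1 + √(1 - ‖a‖ ^ 2) : ℝ) : ℂ)⁻¹) * inner ℂ a x.1) • a‖ ≤ ‖x‖ := by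
      rw [norm_smul, norm_mul, norm_inv, Complex.norm_real, Real.norm_of_nonneg (by positivity)]
      refine (mul_le_of_le_one_right (by positivity) ha.le).trans ?_
      exact (mul_le_of_le_one_left (norm_nonneg _) (inv_le_one_of_one_le₀ (by linarith))).trans h3
    have := norm_sub_le (x.2 • a - ((√(1 - ‖a‖ ^ 2) : ℝ) : ℂ) • x.1)
      (((((1 + √(1 - ‖a‖ ^ 2) : ℝ) : ℂ)⁻¹) * inner ℂ a x.1) • a)
    have := norm_sub_le (x.2 • a) (((√(1 - ‖a‖ ^ 2) : ℝ) : ℂ) • x.1)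
    linarith
  · have := norm_sub_le x.2 (inner ℂ a x.1)
    linarith [norm_nonneg x]

theorem inner_self_eq_one_sub_sqrt_sq {a : E} (ha : ‖a‖ < 1) :
    inner ℂ a a = 1 - ((√(1 - ‖a‖ ^ 2) : ℝ) : ℂ) ^ 2 := by
  rw [inner_self_eq_norm_sq_to_K, ← Complex.ofReal_pow,
    Real.sq_sqrt (by nlinarith [norm_nonneg a])]
  push_cast
  simp

/-- With `⟪a, a⟫ = 1 - s²`, this relation reduces the matrix identities below to polynomial algebra.
-/
theorem one_add_sqrt_mul_inv (r : ℝ) : ((1 + √r : ℝ) : ℂ)⁻¹ * (1 + ((√r : ℝ) : ℂ)) = 1 := by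
  have : ((1 + √r : ℝ) : ℂ) ≠ 0 := by
    exact_mod_cast (by positivity : (0 : ℝ) < 1 + √r).ne'
  rw [← Complex.ofReal_one, ← Complex.ofReal_add]
  exact inv_mul_cancel₀ this

theorem moebiusMatrix_mul_self {a : E} (ha : ‖a‖ < 1) :
    moebiusMatrix a * moebiusMatrix a = ((1 - ‖a‖ ^ 2 : ℝ) : ℂ) • 1 := by
  have hα := inner_self_eq_one_sub_sqrt_sq ha
  have hk := one_add_sqrt_mul_inv (1 - ‖a‖ ^ 2)
  have hs : ((1 - ‖a‖ ^ 2 : ℝ) : ℂ) = ((√(1 - ‖a‖ ^ 2) : ℝ) : ℂ) ^ 2 := by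
    rw [← Complex.ofReal_pow, Real.sq_sqrt (by nlinarith [norm_nonneg a])]
  rw [hs]
  refine ContinuousLinearMap.ext fun x => ?_
  rw [mul_apply_eq_comp]
  change _ = ((√(1 - ‖a‖ ^ 2) : ℝ) : ℂ) ^ 2 • x
  refine Prod.ext ?_ ?_
  · rw [Prod.smul_fst, moebiusMatrix_apply_fst, moebiusMatrix_apply_snd, moebiusMatrix_apply_fst]
    simp only [inner_sub_right, inner_smul_right, hα]
    set s := ((√(1 - ‖a‖ ^ 2) : ℝ) : ℂ)
    set k := ((1 + √(1 - ‖a‖ ^ 2) : ℝ) : ℂ)⁻¹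
    set t := inner ℂ a x.1
    match_scalars
    · linear_combination (-x.2 * (1 - s) + k * t * (1 - s) + t) * hk
    · ring
  · rw [Prod.smul_snd, moebiusMatrix_apply_snd, moebiusMatrix_apply_snd, moebiusMatrix_apply_fst]
    simp only [inner_sub_right, inner_smul_right, hα, smul_eq_mul]
    set s := ((√(1 - ‖a‖ ^ 2) : ℝ) : ℂ)
    set k := ((1 + √(1 - ‖a‖ ^ 2) : ℝ) : ℂ)⁻¹
    set t := inner ℂ a x.1
    linear_combination (t * (1 - s)) * hk

theorem lorentzForm_moebiusMatrix {a : E} (ha : ‖a‖ < 1) (x y : E × ℂ) :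
    lorentzForm (moebiusMatrix a x) (moebiusMatrix a y) =
      ((1 - ‖a‖ ^ 2 : ℝ) : ℂ) * lorentzForm x y := by
  have hα := inner_self_eq_one_sub_sqrt_sq ha
  have hk := one_add_sqrt_mul_inv (1 - ‖a‖ ^ 2)
  have hs : ((1 - ‖a‖ ^ 2 : ℝ) : ℂ) = ((√(1 - ‖a‖ ^ 2) : ℝ) : ℂ) ^ 2 := by
    rw [← Complex.ofReal_pow, Real.sq_sqrt (by nlinarith [norm_nonneg a])]
  have hkc : conj ((1 + √(1 - ‖a‖ ^ 2) : ℝ) : ℂ)⁻¹ = ((1 + √(1 - ‖a‖ ^ 2) : ℝ) : ℂ)⁻¹ := by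
    rw [map_inv₀, Complex.conj_ofReal]
  simp only [lorentzForm, moebiusMatrix_apply_fst, moebiusMatrix_apply_snd, inner_sub_right,
    inner_sub_left, inner_smul_right, inner_smul_left, map_sub, map_mul, hα, hs,
    Complex.conj_ofReal, hkc, inner_conj_symm]
  set s := ((√(1 - ‖a‖ ^ 2) : ℝ) : ℂ)
  set k := ((1 + √(1 - ‖a‖ ^ 2) : ℝ) : ℂ)⁻¹
  set t := inner ℂ a y.1
  set r := inner ℂ x.1 a
  linear_combination ((1 - s) * (conj x.2 * t + r * y.2) - (k * (1 - s) + 1) * r * t) * hk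

end Moebius

/-! ### Projective lifts of ball automorphisms -/

section Automorphisms

open Metric

variable {n : ℕ}

local notation "𝔼" n => EuclideanSpace ℂ (Fin n)

/-- The endomorphism `M` of `ℂⁿ × ℂ` induces the self-map `γ` of the ball in the affine chart
`z ↦ (z, 1)`. -/
def IsProjectiveLift (M : (𝔼 n) × ℂ →L[ℂ] (𝔼 n) × ℂ) (γ : unitBall n → unitBall n) : Prop :=
  ∀ z : unitBall n, ∃ c : ℂ, c ≠ 0 ∧ M (z, 1) = c • ((γ z : 𝔼 n), (1 : ℂ))

theorem IsProjectiveLift.mul {M N : (𝔼 n) × ℂ →L[ℂ] (𝔼 n) × ℂ} {γ δ : unitBall n → unitBall n}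
    (hM : IsProjectiveLift M γ) (hN : IsProjectiveLift N δ) : IsProjectiveLift (M * N) (γ ∘ δ) := by
  intro z
  obtain ⟨c, hc, h1⟩ := hN z
  obtain ⟨d, hd, h2⟩ := hM (δ z)
  exact ⟨c * d, mul_ne_zero hc hd, by
    rw [mul_apply_eq_comp, h1, map_smul, h2, smul_smul, Function.comp_apply]⟩

theorem IsProjectiveLift.smul {M : (𝔼 n) × ℂ →L[ℂ] (𝔼 n) × ℂ} {γ : unitBall n → unitBall n}
    (hM : IsProjectiveLift M γ) {c : ℂ} (hc : c ≠ 0) : IsProjectiveLift (c • M) γ := by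
  intro z
  obtain ⟨d, hd, h⟩ := hM z
  exact ⟨c * d, mul_ne_zero hc hd, by rw [smul_apply, h, smul_smul]⟩

theorem IsProjectiveLift.snd_ne_zero {M : (𝔼 n) × ℂ →L[ℂ] (𝔼 n) × ℂ}
    {γ : unitBall n → unitBall n} (hM : IsProjectiveLift M γ) (z : unitBall n) :
    (M (z, 1)).2 ≠ 0 := by
  obtain ⟨c, hc, h⟩ := hM z
  simpa [h] using hc

theorem IsProjectiveLift.apply_eq {M : (𝔼 n) × ℂ →L[ℂ] (𝔼 n) × ℂ}
    {γ : unitBall n → unitBall n} (hM : IsProjectiveLift M γ) (z : unitBall n) :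
    (M (z, 1)).2⁻¹ • (M (z, 1)).1 = γ z := by
  obtain ⟨c, hc, h⟩ := hM z
  simp [h, smul_smul, hc]

theorem IsProjectiveLift.isHolomorphicMap {M : (𝔼 n) × ℂ →L[ℂ] (𝔼 n) × ℂ}
    {γ : unitBall n → unitBall n} (hM : IsProjectiveLift M γ) : IsHolomorphicMap γ := by
  refine ⟨fun z => (M (z, 1)).2⁻¹ • (M (z, 1)).1, fun z hz => ?_, hM.apply_eq⟩
  have h : DifferentiableAt ℂ (fun z : 𝔼 n => M (z, 1)) z := by fun_prop
  exact ((h.snd.inv (hM.snd_ne_zero ⟨z, hz⟩)).smul h.fst).differentiableWithinAt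

/-- A similitude of the Lorentz form with positive multiplier induces a self-map of the ball. -/
theorem exists_isProjectiveLift_of_lorentzForm {M : (𝔼 n) × ℂ →L[ℂ] (𝔼 n) × ℂ} {c : ℝ}
    (hc : 0 < c) (hM : ∀ x, lorentzForm (M x) (M x) = (c : ℂ) * lorentzForm x x) :
    ∃ γ : unitBall n → unitBall n, IsProjectiveLift M γ := by
  have key : ∀ z : unitBall n, ‖(M (z, 1)).1‖ < ‖(M (z, 1)).2‖ := by
    intro z
    have h := hM (z, 1)
    rw [lorentzForm_self, lorentzForm_self] at h
    have h1 : ‖(M (z, 1)).2‖ ^ 2 - ‖(M (z, 1)).1‖ ^ 2 = c * (‖(1 : ℂ)‖ ^ 2 - ‖(z : 𝔼 n)‖ ^ 2) := by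
      exact Complex.ofReal_injective (by rw [h, Complex.ofReal_mul])
    have hz : ‖(z : 𝔼 n)‖ < 1 := mem_ball_zero_iff.1 z.2
    have h2 : 0 < c * (‖(1 : ℂ)‖ ^ 2 - ‖(z : 𝔼 n)‖ ^ 2) := by
      rw [norm_one]
      exact mul_pos hc (by nlinarith [norm_nonneg (z : 𝔼 n)])
    refine lt_of_pow_lt_pow_left₀ 2 (norm_nonneg _) (by linarith)
  have hpos : ∀ z : unitBall n, 0 < ‖(M (z, 1)).2‖ := fun z => (norm_nonneg _).trans_lt (key z)
  refine ⟨fun z => ⟨(M (z, 1)).2⁻¹ • (M (z, 1)).1, ?_⟩, fun z =>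
    ⟨(M (z, 1)).2, norm_pos_iff.1 (hpos z), ?_⟩⟩
  · rw [mem_ball_zero_iff, norm_smul, norm_inv, inv_mul_lt_iff₀ (hpos z), mul_one]
    exact key z
  · refine Prod.ext ?_ (by simp)
    simp [smul_smul, norm_pos_iff.1 (hpos z)]

theorem IsProjectiveLift.congr {M : (𝔼 n) × ℂ →L[ℂ] (𝔼 n) × ℂ} {γ δ : unitBall n → unitBall n}
    (hγ : IsProjectiveLift M γ) (hδ : IsProjectiveLift M δ) : γ = δ :=
  funext fun z => Subtype.ext ((hγ.apply_eq z).symm.trans (hδ.apply_eq z))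

theorem isProjectiveLift_one : IsProjectiveLift (n := n) 1 id :=
  fun z => ⟨1, one_ne_zero, by simp⟩

/-- The involutive automorphism of the ball given by `moebiusMatrix a` takes `0` to `a`. -/
theorem exists_ballAut_moebius {a : 𝔼 n} (ha : ‖a‖ < 1) :
    ∃ φ : ballAut n, IsProjectiveLift (moebiusMatrix a) (ballAut.toFun φ) ∧ φ * φ = 1 ∧
      (ballAut.toFun φ ⟨0, mem_ball_self one_pos⟩ : 𝔼 n) = a := by
  have hpos : 0 < 1 - ‖a‖ ^ 2 := by nlinarith [norm_nonneg a]
  obtain ⟨γ, hγ⟩ := exists_isProjectiveLift_of_lorentzForm hpos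
    fun x => lorentzForm_moebiusMatrix ha x x
  have hinv : γ ∘ γ = id := by
    have h1 := hγ.mul hγ
    rw [moebiusMatrix_mul_self ha] at h1
    exact h1.congr (isProjectiveLift_one.smul (by exact_mod_cast hpos.ne'))
  let e : Equiv.Perm (unitBall n) := ⟨γ, γ, congrFun hinv, congrFun hinv⟩
  refine ⟨⟨e, hγ.isHolomorphicMap, hγ.isHolomorphicMap⟩, hγ, ?_, ?_⟩
  · exact Subtype.ext (Equiv.ext (congrFun hinv))
  · have := hγ.apply_eq ⟨0, mem_ball_self one_pos⟩
    rw [moebiusMatrix_zero_one] at this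
    exact this.symm.trans (by simp)

theorem ballAut.toFun_mul (γ δ : ballAut n) :
    ballAut.toFun (γ * δ) = ballAut.toFun γ ∘ ballAut.toFun δ := rfl

theorem ballAut.toFun_one : ballAut.toFun (1 : ballAut n) = id := rfl

theorem ballAut.toFun_injective : Function.Injective (ballAut.toFun (n := n)) :=
  fun _ _ h => Subtype.ext (Equiv.ext (congrFun h))

theorem ballAut.toFun_inv_apply_self (γ : ballAut n) (z : unitBall n) :
    ballAut.toFun γ⁻¹ (ballAut.toFun γ z) = z := by
  rw [← Function.comp_apply (f := ballAut.toFun γ⁻¹), ← toFun_mul, inv_mul_cancel, toFun_one, id]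

theorem ballAut.toFun_apply_inv_self (γ : ballAut n) (z : unitBall n) :
    ballAut.toFun γ (ballAut.toFun γ⁻¹ z) = z := by
  simpa using ballAut.toFun_inv_apply_self γ⁻¹ z

/-- A norm preserving holomorphic self-map of the ball is linear. -/
theorem eq_fderiv_of_norm_preserving {f : (𝔼 n) → 𝔼 n} (hf : DifferentiableOn ℂ f (ball 0 1))
    (hnorm : ∀ z ∈ ball (0 : 𝔼 n) 1, ‖f z‖ = ‖z‖) :
    ∀ z ∈ ball (0 : 𝔼 n) 1, f z = fderiv ℂ f 0 z := by
  have hf0 : f 0 = 0 := by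
    simpa using hnorm 0 (mem_ball_self one_pos)
  intro z hz
  rcases eq_or_ne z 0 with rfl | hz0
  · rw [hf0, map_zero]
  have hzn : ‖z‖ ≠ 0 := norm_ne_zero_iff.2 hz0
  set u : 𝔼 n := (‖z‖ : ℂ)⁻¹ • z with hu
  have hu1 : ‖u‖ = 1 := by simp [hu, norm_smul, hzn]
  have hzu : z = (‖z‖ : ℂ) • u := by
    rw [hu, smul_inv_smul₀ (by exact_mod_cast hzn)]
  set g : ℂ → 𝔼 n := fun ζ => f (ζ • u) with hg
  have hmem : ∀ ζ ∈ ball (0 : ℂ) 1, ζ • u ∈ ball (0 : 𝔼 n) 1 := fun ζ hζ => by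
    simpa [norm_smul, hu1] using hζ
  have hgn : ∀ ζ ∈ ball (0 : ℂ) 1, ‖g ζ‖ = ‖ζ‖ := fun ζ hζ => by
    rw [hg, hnorm _ (hmem ζ hζ), norm_smul, hu1, mul_one]
  have hg0 : g 0 = 0 := by simp [hg, hf0]
  have hgd : DifferentiableOn ℂ g (ball 0 1) :=
    hf.comp (by fun_prop) hmem
  have hhalf : (2⁻¹ : ℂ) ∈ ball (0 : ℂ) 1 := by
    rw [mem_ball_zero_iff, norm_inv, Complex.norm_ofNat]
    norm_num
  -- Equality in the Schwarz lemma at a single nonzero point, here `1/2`, forces `g` to be affine,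
  -- as the Euclidean norm is strictly convex.
  have haff := Complex.affine_of_mapsTo_ball_of_norm_dslope_eq_div (R₂ := 1) hgd
    (fun ζ hζ => by
      rw [hg0, mem_closedBall_zero_iff, hgn ζ hζ]
      exact (mem_ball_zero_iff.1 hζ).le) hhalf (by
      rw [dslope_of_ne _ (by norm_num), slope_def_module, hg0, sub_zero, sub_zero, norm_smul,
        hgn _ hhalf, norm_inv, norm_inv, inv_inv, Complex.norm_ofNat]
      norm_num)
  set C := dslope g 0 2⁻¹
  have hgC : ∀ ζ ∈ ball (0 : ℂ) 1, g ζ = ζ • C := fun ζ hζ => by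
    simpa [hg0] using haff hζ
  have h1 : HasDerivAt g C 0 := by
    have h2 : HasDerivAt (fun ζ : ℂ => ζ • C) C 0 := by
      simpa using (hasDerivAt_id (0 : ℂ)).smul_const C
    exact h2.congr_of_eventuallyEq
      (Filter.eventually_of_mem (ball_mem_nhds 0 one_pos) hgC)
  have h3 : HasDerivAt g (fderiv ℂ f 0 u) 0 := by
    have h4 : HasDerivAt (fun ζ : ℂ => ζ • u) u 0 := by
      simpa using (hasDerivAt_id (0 : ℂ)).smul_const u
    have h5 : HasFDerivAt f (fderiv ℂ f 0) ((0 : ℂ) • u) := by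
      rw [zero_smul]
      exact (hf.differentiableAt (ball_mem_nhds 0 one_pos)).hasFDerivAt
    exact h5.comp_hasDerivAt 0 h4
  have hzb : (‖z‖ : ℂ) ∈ ball (0 : ℂ) 1 := by simpa using hz
  calc f z = g (‖z‖ : ℂ) := by rw [hg]; exact congrArg f hzu
    _ = (‖z‖ : ℂ) • fderiv ℂ f 0 u := by rw [hgC _ hzb, h1.unique h3]
    _ = fderiv ℂ f 0 z := by rw [← map_smul, ← hzu]

/-- This is the Schwarz lemma; used for an automorphism and its inverse, it gives norm preservation.
-/
theorem norm_apply_le_of_isHolomorphicMap {γ : unitBall n → unitBall n}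
    (hγ : IsHolomorphicMap γ) {o : unitBall n} (ho : (o : 𝔼 n) = 0) (h0 : γ o = o)
    (z : unitBall n) : ‖(γ z : 𝔼 n)‖ ≤ ‖(z : 𝔼 n)‖ := by
  obtain ⟨F, hF, hFγ⟩ := hγ
  rw [← hFγ]
  refine Complex.norm_le_norm_of_mapsTo_ball hF (fun w hw => ?_) ?_ (mem_ball_zero_iff.1 z.2)
  · rw [hFγ ⟨w, hw⟩]
    exact ball_subset_closedBall (γ ⟨w, hw⟩).2
  · rw [← ho, hFγ o, h0]

/-- Automorphisms of the ball that fix the origin are unitary. -/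
theorem exists_linearIsometryEquiv_of_fixes_zero (γ : ballAut n) {o : unitBall n}
    (ho : (o : 𝔼 n) = 0) (h0 : ballAut.toFun γ o = o) :
    ∃ L : (𝔼 n) ≃ₗᵢ[ℂ] 𝔼 n, ∀ z, (ballAut.toFun γ z : 𝔼 n) = L z := by
  have hinv0 : ballAut.toFun γ⁻¹ o = o := by
    conv_lhs => rw [← h0]
    exact ballAut.toFun_inv_apply_self γ o
  have hnorm : ∀ z, ‖(ballAut.toFun γ z : 𝔼 n)‖ = ‖(z : 𝔼 n)‖ := fun z => by
    refine le_antisymm (norm_apply_le_of_isHolomorphicMap γ.2.1 ho h0 z) ?_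
    have := norm_apply_le_of_isHolomorphicMap (γ⁻¹).2.1 ho hinv0 (ballAut.toFun γ z)
    change ‖(ballAut.toFun γ⁻¹ _ : 𝔼 n)‖ ≤ _ at this
    rwa [ballAut.toFun_inv_apply_self γ] at this
  obtain ⟨F, hF, hFγ⟩ := γ.2.1
  have hFn : ∀ z ∈ ball (0 : 𝔼 n) 1, ‖F z‖ = ‖z‖ := fun z hz => by
    rw [hFγ ⟨z, hz⟩]
    exact hnorm ⟨z, hz⟩
  have hlin := eq_fderiv_of_norm_preserving hF hFn
  have hL : ∀ z, ‖fderiv ℂ F 0 z‖ = ‖z‖ := by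
    intro z
    have hpos : 0 < ‖z‖ + 1 := by positivity
    have hne : (((‖z‖ + 1 : ℝ) : ℂ)⁻¹) ≠ 0 := inv_ne_zero (by exact_mod_cast hpos.ne')
    have hmem : (((‖z‖ + 1 : ℝ) : ℂ)⁻¹) • z ∈ ball (0 : 𝔼 n) 1 := by
      rw [mem_ball_zero_iff, norm_smul, norm_inv, Complex.norm_real,
        Real.norm_of_nonneg hpos.le, inv_mul_lt_iff₀ hpos]
      linarith
    have h1 := hFn _ hmem
    rw [hlin _ hmem, map_smul, norm_smul, norm_smul] at h1
    exact mul_left_cancel₀ (norm_ne_zero_iff.2 hne) h1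
  refine ⟨LinearIsometry.toLinearIsometryEquiv ⟨(fderiv ℂ F 0).toLinearMap, hL⟩ rfl, fun z => ?_⟩
  exact (hFγ z).symm.trans (hlin z z.2)

/-- The block diagonal endomorphism of `E × ℂ` with blocks `L` and `1`. -/
noncomputable def blockOne (L : (𝔼 n) ≃ₗᵢ[ℂ] 𝔼 n) : (𝔼 n) × ℂ →L[ℂ] (𝔼 n) × ℂ :=
  (L.toContinuousLinearEquiv : (𝔼 n) →L[ℂ] 𝔼 n).prodMap (ContinuousLinearMap.id ℂ ℂ)

theorem blockOne_apply (L : (𝔼 n) ≃ₗᵢ[ℂ] 𝔼 n) (x : (𝔼 n) × ℂ) : blockOne L x = (L x.1, x.2) :=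
  rfl

theorem norm_blockOne_le (L : (𝔼 n) ≃ₗᵢ[ℂ] 𝔼 n) : ‖blockOne L‖ ≤ 1 :=
  ContinuousLinearMap.opNorm_le_bound _ zero_le_one fun x => by
    rw [blockOne_apply, Prod.norm_def, L.norm_map, one_mul, Prod.norm_def]

theorem lorentzForm_blockOne (L : (𝔼 n) ≃ₗᵢ[ℂ] 𝔼 n) (x y : (𝔼 n) × ℂ) :
    lorentzForm (blockOne L x) (blockOne L y) = lorentzForm x y := by
  simp [lorentzForm, blockOne_apply]

theorem blockOne_mul_symm (L : (𝔼 n) ≃ₗᵢ[ℂ] 𝔼 n) : blockOne L * blockOne L.symm = 1 :=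
  ContinuousLinearMap.ext fun x => by simp [blockOne_apply]

/-- Every automorphism of the ball is the composition of an involutive Möbius automorphism and a
unitary map. -/
theorem exists_isProjectiveLift_moebius (γ : ballAut n) {a : unitBall n}
    (ha : (ballAut.toFun γ a : 𝔼 n) = 0) :
    ∃ L : (𝔼 n) ≃ₗᵢ[ℂ] 𝔼 n,
      IsProjectiveLift (blockOne L * moebiusMatrix (a : 𝔼 n)) (ballAut.toFun γ) ∧
      IsProjectiveLift (moebiusMatrix (a : 𝔼 n) * blockOne L.symm) (ballAut.toFun γ⁻¹) := by
  obtain ⟨φ, hφ, hφφ, hφ0⟩ := exists_ballAut_moebius (mem_ball_zero_iff.1 a.2)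
  set o : unitBall n := ⟨0, mem_ball_self one_pos⟩ with ho
  have hφa : ballAut.toFun φ o = a := Subtype.ext hφ0
  have hδ0 : ballAut.toFun (γ * φ) o = o := by
    rw [ballAut.toFun_mul, Function.comp_apply, hφa]
    exact Subtype.ext ha
  obtain ⟨L, hL⟩ := exists_linearIsometryEquiv_of_fixes_zero (γ * φ) rfl hδ0
  have hγ : γ = γ * φ * φ := by rw [mul_assoc, hφφ, mul_one]
  have hφi : φ⁻¹ = φ := inv_eq_of_mul_eq_one_left hφφ
  have hγi : γ⁻¹ = φ * (γ * φ)⁻¹ := by rw [mul_inv_rev, hφi, ← mul_assoc, hφφ, one_mul]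
  have h1 : IsProjectiveLift (blockOne L) (ballAut.toFun (γ * φ)) := fun z =>
    ⟨1, one_ne_zero, by rw [one_smul, blockOne_apply, hL]⟩
  have h2 : IsProjectiveLift (blockOne L.symm) (ballAut.toFun (γ * φ)⁻¹) := fun z =>
    ⟨1, one_ne_zero, by
      rw [one_smul, blockOne_apply]
      refine Prod.ext ?_ rfl
      refine (LinearIsometryEquiv.symm_apply_eq L).2 ?_
      rw [← hL, ballAut.toFun_apply_inv_self]⟩
  refine ⟨L, ?_, ?_⟩
  · have := h1.mul hφ
    rwa [← ballAut.toFun_mul, ← hγ] at this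
  · have := hφ.mul h2
    rwa [← ballAut.toFun_mul, ← hγi] at this

/-- An automorphism of the ball lifts to a similitude of the Lorentz form. -/
theorem exists_isProjectiveLift_lorentzForm (γ : ballAut n) :
    ∃ (M : (𝔼 n) × ℂ →L[ℂ] (𝔼 n) × ℂ) (c : ℂ), IsProjectiveLift M (ballAut.toFun γ) ∧
      ∀ x y, lorentzForm (M x) (M y) = c * lorentzForm x y := by
  set o : unitBall n := ⟨0, mem_ball_self one_pos⟩ with ho
  obtain ⟨L, hL, -⟩ := exists_isProjectiveLift_moebius γ (a := ballAut.toFun γ⁻¹ o)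
    (by rw [ballAut.toFun_apply_inv_self])
  refine ⟨_, ((1 - ‖(ballAut.toFun γ⁻¹ o : 𝔼 n)‖ ^ 2 : ℝ) : ℂ), hL, fun x y => ?_⟩
  rw [mul_apply_eq_comp, mul_apply_eq_comp, lorentzForm_blockOne,
    lorentzForm_moebiusMatrix (mem_ball_zero_iff.1 (Subtype.coe_prop _))]

/-- An automorphism of the ball and its inverse have mutually inverse lifts, bounded in terms of
the preimage of the origin. -/
theorem exists_isProjectiveLift_norm_le (γ : ballAut n) {a : unitBall n}
    (ha : (ballAut.toFun γ a : 𝔼 n) = 0) :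
    ∃ M N : (𝔼 n) × ℂ →L[ℂ] (𝔼 n) × ℂ, IsProjectiveLift M (ballAut.toFun γ) ∧
      IsProjectiveLift N (ballAut.toFun γ⁻¹) ∧ M * N = 1 ∧
      ‖M‖ ≤ 3 ∧ ‖N‖ ≤ (1 - ‖(a : 𝔼 n)‖ ^ 2)⁻¹ * 3 := by
  obtain ⟨L, hM, hN⟩ := exists_isProjectiveLift_moebius γ ha
  have ha1 : ‖(a : 𝔼 n)‖ < 1 := mem_ball_zero_iff.1 a.2
  have hpos : 0 < 1 - ‖(a : 𝔼 n)‖ ^ 2 := by nlinarith [norm_nonneg (a : 𝔼 n)]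
  have hne : ((1 - ‖(a : 𝔼 n)‖ ^ 2 : ℝ) : ℂ) ≠ 0 := by exact_mod_cast hpos.ne'
  refine ⟨_, _, hM, hN.smul (inv_ne_zero hne), ?_, ?_, ?_⟩
  · refine ContinuousLinearMap.ext fun x => ?_
    have h1 := congrArg (fun T : (𝔼 n) × ℂ →L[ℂ] (𝔼 n) × ℂ => T (blockOne L.symm x))
      (moebiusMatrix_mul_self ha1)
    have h2 := congrArg (fun T : (𝔼 n) × ℂ →L[ℂ] (𝔼 n) × ℂ => T x) (blockOne_mul_symm L)
    simp only [mul_apply_eq_comp, smul_apply, one_apply_eq_self] at h1 h2 ⊢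
    rw [map_smul, map_smul, h1, map_smul, h2, inv_smul_smul₀ hne]
  · exact (norm_mul_le _ _).trans ((mul_le_of_le_one_left (norm_nonneg _)
      (norm_blockOne_le L)).trans (norm_moebiusMatrix_le ha1))
  · rw [norm_smul, norm_inv, Complex.norm_real, Real.norm_of_nonneg hpos.le]
    gcongr
    exact (norm_mul_le _ _).trans ((mul_le_of_le_one_right (norm_nonneg _)
      (norm_blockOne_le _)).trans (norm_moebiusMatrix_le ha1))

end Automorphisms

/-! ### The induced homomorphism and finiteness of its kernel -/

section InducedHom

open Metric Filter Topology

variable {n N : ℕ}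

local notation "𝔼" n => EuclideanSpace ℂ (Fin n)

/-- By Cauchy–Schwarz, `⟪p, q⟫ = 1` is impossible in the open ball. This allows cancelling the form
when eigenvalues are compared. -/
theorem lorentzForm_ne_zero_of_mem_ball (p q : unitBall N) :
    lorentzForm ((p : 𝔼 N), (1 : ℂ)) ((q : 𝔼 N), (1 : ℂ)) ≠ 0 := by
  intro h
  have h1 : inner ℂ (p : 𝔼 N) (q : 𝔼 N) = 1 := by
    rw [lorentzForm, map_one, one_mul] at h
    exact (sub_eq_zero.1 h).symm
  have h2 := norm_inner_le_norm (𝕜 := ℂ) (p : 𝔼 N) (q : 𝔼 N)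
  rw [h1, norm_one] at h2
  have hp := mem_ball_zero_iff.1 p.2
  have hq := mem_ball_zero_iff.1 q.2
  nlinarith [norm_nonneg (p : 𝔼 N), norm_nonneg (q : 𝔼 N)]

/-- The affine subspace of the points of the affine chart that are eigenvectors of `M` for the
eigenvalue `d`. -/
def eigenAffineSubspace (M : (𝔼 N) × ℂ →L[ℂ] (𝔼 N) × ℂ) (d : ℂ) : AffineSubspace ℂ (𝔼 N) where
  carrier := {z | M (z, 1) = d • (z, 1)}
  smul_vsub_vadd_mem' := by
    intro c p q r hp hq hr
    simp only [Set.mem_ofPred_eq, vsub_eq_sub, vadd_eq_add] at hp hq hr ⊢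
    have h : ((c • (p - q) + r, 1) : (𝔼 N) × ℂ) = c • ((p, 1) - (q, 1)) + (r, 1) := by simp
    rw [h, map_add, map_smul, map_sub, hp, hq, hr, smul_add, ← smul_sub, smul_comm]

/-- An automorphism of the target ball that fixes the image of a minimal map is trivial. -/
theorem eq_one_of_fixes_minimal {f : unitBall n → unitBall N} (hmin : IsMinimalMap f)
    {ψ : ballAut N} (hψ : ballAut.toFun ψ ∘ f = f) : ψ = 1 := by
  obtain ⟨M, c, hM, hc⟩ := exists_isProjectiveLift_lorentzForm ψ
  have hfix : ∀ z, ∃ d : ℂ, d ≠ 0 ∧ M (f z, 1) = d • ((f z : 𝔼 N), (1 : ℂ)) := fun z => by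
    have h := hM (f z)
    rwa [show ballAut.toFun ψ (f z) = f z from congrFun hψ z] at h
  choose d hd0 hd using hfix
  -- The similitude identity at two image points ties their eigenvalues together; fixing one point
  -- then shows that `d` is constant.
  have hcc : ∀ z w, star (d z) * d w = c := fun z w => by
    have h := hc (f z, 1) (f w, 1)
    rw [hd, hd, lorentzForm_smul_smul] at h
    exact mul_right_cancel₀ (lorentzForm_ne_zero_of_mem_ball _ _) h
  set o : unitBall n := ⟨0, mem_ball_self one_pos⟩
  have hdo : ∀ z, d z = d o := fun z =>
    mul_left_cancel₀ (star_ne_zero.2 (hd0 o)) ((hcc o z).trans (hcc o o).symm)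
  have hmem : ∀ z, (f z : 𝔼 N) ∈ eigenAffineSubspace M (d o) := fun z => by
    rw [← hdo z]
    exact hd z
  have hfin : N ≤ Module.finrank ℂ (eigenAffineSubspace M (d o)).direction := by
    by_contra h
    exact hmin ⟨_, not_le.1 h, hmem⟩
  have hdir : (eigenAffineSubspace M (d o)).direction = ⊤ := by
    refine Submodule.eq_top_of_finrank_eq (le_antisymm (Submodule.finrank_le _) ?_)
    rwa [finrank_euclideanSpace_fin]
  have htop := (AffineSubspace.direction_eq_top_iff_of_nonempty ⟨_, hmem o⟩).1 hdir
  refine ballAut.toFun_injective (hM.congr fun z => ⟨d o, hd0 o, ?_⟩)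
  have hz : (z : 𝔼 N) ∈ eigenAffineSubspace M (d o) := htop ▸ AffineSubspace.mem_top ℂ _ _
  exact hz

/-- The quotient `χ * ψ⁻¹` is paired with the identity, hence fixes the image of `f`. -/
theorem eq_of_mem_pairGroup {f : unitBall n → unitBall N} (hmin : IsMinimalMap f)
    {γ : ballAut n} {ψ χ : ballAut N} (hψ : (γ, ψ) ∈ pairGroup f) (hχ : (γ, χ) ∈ pairGroup f) :
    ψ = χ := by
  have h : (γ * γ⁻¹, χ * ψ⁻¹) ∈ pairGroup f := mul_mem hχ (inv_mem hψ)
  rw [mul_inv_cancel] at h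
  have h1 : f = ballAut.toFun (χ * ψ⁻¹) ∘ f := h
  exact (mul_inv_eq_one.1 (eq_one_of_fixes_minimal hmin h1.symm)).symm

theorem exists_mem_pairGroup {f : unitBall n → unitBall N} (γ : sourceGroup f) :
    ∃ ψ : targetGroup f, ((γ : ballAut n), (ψ : ballAut N)) ∈ pairGroup f := by
  obtain ⟨⟨γ', ψ⟩, hp, h⟩ := γ.2
  refine ⟨⟨ψ, ⟨(γ', ψ), hp, rfl⟩⟩, ?_⟩
  rw [← h]
  exact hp

theorem existsUnique_isInducedHom {f : unitBall n → unitBall N} (hmin : IsMinimalMap f) :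
    ∃! Φ : sourceGroup f →* targetGroup f, IsInducedHom f Φ := by
  choose Φ hΦ using exists_mem_pairGroup (f := f)
  refine ⟨MonoidHom.mk' Φ fun a b => ?_, fun γ ψ => ⟨fun h => ?_, ?_⟩, fun Ψ hΨ => ?_⟩
  · exact Subtype.ext (eq_of_mem_pairGroup hmin (hΦ (a * b)) (mul_mem (hΦ a) (hΦ b)))
  · exact eq_of_mem_pairGroup hmin h (hΦ γ)
  · rintro rfl
    exact hΦ γ
  · exact MonoidHom.ext fun γ => Subtype.ext
      (eq_of_mem_pairGroup hmin ((hΨ γ _).2 rfl) (hΦ γ))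

theorem IsInducedHom.map_ker {f : unitBall n → unitBall N}
    {Φ : sourceGroup f →* targetGroup f} (hΦ : IsInducedHom f Φ) :
    Φ.ker.map (sourceGroup f).subtype = invariantGroup f := by
  have key : ∀ γ : sourceGroup f, γ ∈ Φ.ker ↔ (γ : ballAut n) ∈ invariantGroup f := fun γ => by
    rw [MonoidHom.mem_ker, ← Subtype.coe_inj, eq_comm]
    exact (hΦ γ 1).symm
  ext γ
  constructor
  · rintro ⟨δ, hδ, rfl⟩
    exact (key δ).1 hδ
  · intro h
    exact ⟨⟨γ, ⟨(γ, 1), h, rfl⟩⟩, (key _).2 h, rfl⟩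

/-- An infinite group of automorphisms that move the origin within a compact set contains
nontrivial elements with lifts arbitrarily close to the identity. -/
theorem exists_lifts_tendsto_one {G : Subgroup (ballAut n)} [Infinite G] {o : unitBall n}
    (ho : (o : 𝔼 n) = 0) {K : Set (unitBall n)} (hK : IsCompact K)
    (hGK : ∀ γ ∈ G, ballAut.toFun γ o ∈ K) :
    ∃ (δ : ℕ → G) (M : ℕ → (𝔼 n) × ℂ →L[ℂ] (𝔼 n) × ℂ),
      (∀ j, IsProjectiveLift (M j) (ballAut.toFun (δ j))) ∧ (∀ j, δ j ≠ 1) ∧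
        Tendsto M atTop (𝓝 1) := by
  obtain ⟨C, hC⟩ := hK.exists_bound_of_continuousOn
    (f := fun a : unitBall n => (1 - ‖(a : 𝔼 n)‖ ^ 2)⁻¹ * 3) (by
      refine Continuous.continuousOn ((Continuous.inv₀ (by fun_prop) fun a => ?_).mul_const 3)
      have := mem_ball_zero_iff.1 a.2
      nlinarith [norm_nonneg (a : 𝔼 n)])
  have hlift : ∀ γ : G, ∃ M N : (𝔼 n) × ℂ →L[ℂ] (𝔼 n) × ℂ,
      IsProjectiveLift M (ballAut.toFun γ) ∧ IsProjectiveLift N (ballAut.toFun (γ : ballAut n)⁻¹) ∧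
        M * N = 1 ∧ ‖M‖ ≤ 3 ∧ ‖N‖ ≤ C := fun γ => by
    obtain ⟨M, N, h1, h2, h3, h4, h5⟩ := exists_isProjectiveLift_norm_le (γ : ballAut n)
      (a := ballAut.toFun (γ : ballAut n)⁻¹ o) (by rw [ballAut.toFun_apply_inv_self, ho])
    exact ⟨M, N, h1, h2, h3, h4, h5.trans
      ((le_abs_self _).trans (hC _ (hGK _ (inv_mem γ.2))))⟩
  choose M N hM hN hMN hM3 hNC using hlift
  set g : ℕ ↪ G := Infinite.natEmbedding G
  have : ProperSpace ((𝔼 n) × ℂ →L[ℂ] (𝔼 n) × ℂ) := FiniteDimensional.proper ℂ _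
  obtain ⟨T, -, φ, hφ, hlim⟩ := tendsto_subseq_of_bounded (x := fun j => M (g j))
    (isBounded_closedBall (x := 0) (r := 3)) fun j => mem_closedBall_zero_iff.2 (hM3 (g j))
  have hdiff : Tendsto (fun j => M (g (φ (j + 1))) - M (g (φ j))) atTop (𝓝 0) := by
    have := (hlim.comp (tendsto_add_atTop_nat 1)).sub hlim
    rwa [sub_self] at this
  -- Consecutive quotients are nontrivial because `g ∘ φ` is injective. As `N` inverts `M` on the
  -- right, their lifts differ from `1` by `(M' - M) * N`, which is small since `N` is bounded.
  refine ⟨fun j => g (φ (j + 1)) * (g (φ j))⁻¹, fun j => M (g (φ (j + 1))) * N (g (φ j)),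
    fun j => (hM _).mul (hN _), fun j h => ?_, ?_⟩
  · exact (Nat.succ_ne_self j) (hφ.injective (g.injective (mul_inv_eq_one.1 h)))
  · rw [tendsto_iff_norm_sub_tendsto_zero]
    have hb := hdiff.norm.mul_const C
    rw [norm_zero, zero_mul] at hb
    refine squeeze_zero (fun _ => norm_nonneg _) (fun j => ?_) hb
    calc ‖M (g (φ (j + 1))) * N (g (φ j)) - 1‖
        = ‖(M (g (φ (j + 1))) - M (g (φ j))) * N (g (φ j))‖ := by rw [sub_mul, hMN]
      _ ≤ _ := (norm_mul_le _ _).trans (mul_le_mul_of_nonneg_left (hNC _) (norm_nonneg _))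

/-- The group of automorphisms leaving a proper holomorphic map between balls invariant is
finite. -/
theorem finite_invariantGroup {f : unitBall n → unitBall N} (hol : IsHolomorphicMap f)
    (hproper : IsProperMap f) : Finite (invariantGroup f) := by
  by_contra hfin
  rw [not_finite_iff_infinite] at hfin
  set o : unitBall n := ⟨0, mem_ball_self one_pos⟩
  obtain ⟨δ, M, hM, hδ, hlim⟩ := exists_lifts_tendsto_one (G := invariantGroup f) (o := o) rfl
    (hproper.isCompact_preimage (isCompact_singleton (x := f o)))
    fun γ (hγ : f ∘ ballAut.toFun γ = f) => congrFun hγ o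
  -- A scalar lift would induce the identity, contradicting `δ j ≠ 1`; the scalar is nonzero since
  -- lifts have nonzero last coordinate on the ball.
  have hscalar : ∀ j (c : ℂ), M j ≠ c • 1 := by
    intro j c h
    have hc : c ≠ 0 := by
      rintro rfl
      refine (hM j).snd_ne_zero o ?_
      rw [h, smul_apply]
      exact zero_mul _
    refine hδ j (Subtype.ext (ballAut.toFun_injective ((hM j).congr ?_)))
    rw [h]
    exact isProjectiveLift_one.smul hc
  obtain ⟨F, hF, hFf⟩ := hol
  obtain ⟨V, hV0, hV01, hV⟩ := exists_projectiveField_of_tendsto_one (F := 𝔼 N) hlim hscalar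
  refine hV0 (eq_zero_of_projectiveField_eq_zero one_pos hV01 fun p hp =>
    projectiveField_eq_zero_of_fderiv_eq_zero isOpen_ball hF (fun q hq => ?_) V
      (fun y hy => ?_) hp)
  · have h : {z | z ∈ unitBall n ∧ F z = F q} = Subtype.val '' (f ⁻¹' {f ⟨q, hq⟩}) := by
      ext z
      constructor
      · rintro ⟨hz, h⟩
        refine ⟨⟨z, hz⟩, Subtype.ext ?_, rfl⟩
        rw [← hFf, ← hFf]
        exact h
      · rintro ⟨w, hw, rfl⟩
        refine ⟨w.2, ?_⟩
        rw [hFf, show f w = f ⟨q, hq⟩ from hw, ← hFf]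
    rw [h]
    exact (hproper.isCompact_preimage isCompact_singleton).image continuous_subtype_val
  · refine hV F _ y (hF.differentiableAt (isOpen_ball.mem_nhds hy)).hasFDerivAt fun j => ?_
    rw [(hM j).apply_eq ⟨y, hy⟩, hFf,
      show f (ballAut.toFun (δ j) ⟨y, hy⟩) = f ⟨y, hy⟩ from congrFun (δ j).2 _, ← hFf]

end InducedHom

/-- Let `f : 𝔹ⁿ → 𝔹ᴺ` be a minimal proper holomorphic map. Then the induced homomorphism
`Φ : Γ_f → T_f` exists and is unique, and its kernel, as a subgroup of `Aut(𝔹ⁿ)`, is equal to `G_f`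
and is finite. -/
theorem proposition3p2 {n N : ℕ} (f : unitBall n → unitBall N) (hol : IsHolomorphicMap f)
    (hproper : IsProperMap f) (hmin : IsMinimalMap f) :
    (∃! Φ : sourceGroup f →* targetGroup f, IsInducedHom f Φ) ∧
    ∀ Φ : sourceGroup f →* targetGroup f, IsInducedHom f Φ →
      Φ.ker.map (sourceGroup f).subtype = invariantGroup f ∧
      Finite (Φ.ker.map (sourceGroup f).subtype) := by
  refine ⟨existsUnique_isInducedHom hmin, fun Φ hΦ => ⟨hΦ.map_ker, ?_⟩⟩
  rw [hΦ.map_ker]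
  exact finite_invariantGroup hol hproper
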